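/- Let $(X,d)$ be a proper geodesic Gromov hyperbolic metric space, with Gromov boundary $\partial_G X$ (the geodesic rays $[0,+\infty)\to X$ modulo staying at bounded distance) and Gromov compactification $\overline X^G = X\sqcup\partial_G X$. The endpoint of a geodesic ray is its class in $\partial_GX$. Let $f\colon X\to X$ be non-expanding, i.e. $d(f(x),f(y))\le d(x,y)$ for all $x,y\in X$, and let $\eta\in\partial_G X$. For $p\in X$ the dilation $\lambda_{\eta,p}\in(0,+\infty]$ of $f$ at $\eta$ is defined by $$\log\lambda_{\eta,p}=\liminf_{z\to\eta}\bigl(d(z,p)-d(f(z),p)\bigr);$$ whether it is finite does not depend on $p$. The point $\eta$ is a *boundary regular fixed point* (BRFP) of $f$ if $\lambda_{\eta,p}<+\infty$ and $f$ has geodesic limit $\eta$ at $\eta$, that is, $f(x_n)\to\eta$ for every sequence $(x_n)$ in $X$ that converges to $\eta$ and is contained in some set $\{x\in X: d(x,\gamma)<R\}$, where $R>0$ and $\gamma$ is a geodesic ray with endpoint $\eta$. For $B\ge 0$, a curve $\sigma\colon[0,+\infty)\to X$ is a $(1,B)$-quasi-geodesic if $|t-s|-B\le d(\sigma(s),\sigma(t))\le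 |t-s|+B$ for all $s,t\ge 0$; it has endpoint $\eta$ if $\sigma(t)\to\eta$ in $\overline X^G$ as $t\to+\infty$. Then the following are equivalent: 1. $\eta$ is a BRFP of $f$; 2. there exists a geodesic ray $\gamma$ with endpoint $\eta$ such that the curve $f\circ\gamma$ is, for some $B\ge 0$, a $(1,B)$-quasi-geodesic with endpoint $\eta$; 3. there exists a geodesic ray $\gamma$ with endpoint $\eta$ such that $\limsup_{t\to+\infty} d(\gamma(t),f(\gamma(t)))<+\infty$; 4. $\liminf_{z\to\eta} d(z,f(z))<+\infty$. -/

import Mathlib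

open Set Filter Topology
open scoped NNReal ENNReal

namespace GromovHyp

/-- `S` is (the image of) a geodesic segment from `x` to `y`. -/
def IsGeodesicSegment {X : Type*} [MetricSpace X] (S : Set X) (x y : X) : Prop :=
  ∃ c : ℝ → X, c 0 = x ∧ c (dist x y) = y ∧
    (∀ s ∈ Icc 0 (dist x y), ∀ t ∈ Icc 0 (dist x y), dist (c s) (c t) = |s - t|) ∧
    S = c '' Icc 0 (dist x y)

/-- Geodesic metric space: any two points are joined by a geodesic segment. -/
def IsGeodesicSpace (X : Type*) [MetricSpace X] : Prop :=
  ∀ x y : X, ∃ S : Set X, IsGeodesicSegment S x y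

/-- Thin triangles: every side of every geodesic triangle lies in the `δ`-neighbourhood of the
union of the two other sides. (All sides are covered, as the vertices can be permuted.) -/
def IsDeltaHyperbolic (X : Type*) [MetricSpace X] (δ : ℝ) : Prop :=
  ∀ (x y z : X) (S₁ S₂ S₃ : Set X),
    IsGeodesicSegment S₁ x y → IsGeodesicSegment S₂ y z → IsGeodesicSegment S₃ z x →
    S₁ ⊆ Metric.thickening δ (S₂ ∪ S₃)

/-- Gromov hyperbolicity (used for proper geodesic spaces). -/
def IsGromovHyperbolic (X : Type*) [MetricSpace X] : Prop :=
  ∃ δ : ℝ, 0 < δ ∧ IsDeltaHyperbolic X δ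

/-- Geodesic rays: isometric embeddings of `[0, ∞)`. -/
def GeodesicRay (X : Type*) [MetricSpace X] : Type _ :=
  {γ : ℝ≥0 → X // Isometry γ}

instance {X : Type*} [MetricSpace X] : CoeFun (GeodesicRay X) (fun _ => ℝ≥0 → X) :=
  ⟨fun γ => γ.1⟩

/-- Two geodesic rays are asymptotic if they stay at bounded distance. -/
def Asymptotic {X : Type*} [MetricSpace X] (γ σ : GeodesicRay X) : Prop :=
  ∃ K : ℝ, ∀ t : ℝ≥0, dist (γ t) (σ t) ≤ K

/-- Being asymptotic is an equivalence relation. -/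
def asymptoticSetoid (X : Type*) [MetricSpace X] : Setoid (GeodesicRay X) where
  r := Asymptotic
  iseqv :=
    { refl := fun γ => ⟨0, fun t => by simp⟩
      symm := fun ⟨K, h⟩ => ⟨K, fun t => by rw [dist_comm]; exact h t⟩
      trans := fun ⟨K, h⟩ ⟨L, k⟩ =>
        ⟨K + L, fun t => (dist_triangle _ _ _).trans (add_le_add (h t) (k t))⟩ }

/-- The Gromov boundary: geodesic rays modulo being asymptotic. -/
def GromovBoundary (X : Type*) [MetricSpace X] : Type _ :=
  Quotient (asymptoticSetoid X)

/-- The endpoint `γ(+∞)` of a geodesic ray. -/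
def GeodesicRay.endpoint {X : Type*} [MetricSpace X] (γ : GeodesicRay X) : GromovBoundary X :=
  Quotient.mk (asymptoticSetoid X) γ

/-- The set underlying the Gromov compactification: the disjoint union of `X` and its
Gromov boundary. -/
inductive GromovCompactification (X : Type*) [MetricSpace X] where
  | point : X → GromovCompactification X
  | bdry : GromovBoundary X → GromovCompactification X

/-- The Gromov product `(x, y)_p`. -/
noncomputable def gromovProduct {X : Type*} [MetricSpace X] (p x y : X) : ℝ :=
  (dist x p + dist y p - dist x y) / 2

/-- The curves representing a point of the compactification: the constant curve for a point of
`X`, the geodesic rays in the class for a boundary point. -/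
def GromovCompactification.reps {X : Type*} [MetricSpace X] :
    GromovCompactification X → Set (ℝ≥0 → X)
  | .point x => {fun _ => x}
  | .bdry η => {c | ∃ γ : GeodesicRay X, γ.endpoint = η ∧ c = γ}

/-- Basic neighbourhoods of a boundary point `η`: the points `z` of the compactification whose
Gromov product with `η` based at `p`, that is, the infimum over representatives `σ` of `z` and
`γ` of `η` of `liminf_{s,t → ∞} (σ(s), γ(t))_p`, is large. -/
def basicNhd {X : Type*} [MetricSpace X] (η : GromovBoundary X) (p : X) (R : ℝ) :
    Set (GromovCompactification X) :=
  {z | ∀ σ ∈ z.reps, ∀ γ ∈ (GromovCompactification.bdry η).reps,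
    ∀ᶠ st : ℝ≥0 × ℝ≥0 in atTop ×ˢ atTop, R ≤ gromovProduct p (σ st.1) (γ st.2)}

/-- Neighbourhood filters of the Gromov compactification. Changing the base point `p` changes
Gromov products by a bounded amount, so that every single `p` would give the same filter. -/
def gromovNhds {X : Type*} [MetricSpace X] :
    GromovCompactification X → Filter (GromovCompactification X)
  | .point x => map GromovCompactification.point (𝓝 x)
  | .bdry η => ⨅ (p : X) (R : ℝ), 𝓟 (basicNhd η p R)

/-- The topology of the Gromov compactification: a set is open if it belongs to `gromovNhds z`
for each of its points `z`. -/
instance {X : Type*} [MetricSpace X] : TopologicalSpace (GromovCompactification X) :=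
  TopologicalSpace.mkOfNhds gromovNhds

/-- The filter on `X` describing `z → η`, for `z` in `X` and `η` in the Gromov boundary. -/
def toBoundary {X : Type*} [MetricSpace X] (η : GromovBoundary X) : Filter X :=
  comap GromovCompactification.point (𝓝 (GromovCompactification.bdry η))

/-- `(A, B)`-quasi-geodesic rays (for `A ≥ 1`, `B ≥ 0`). -/
def IsQuasiGeodesicRay {X : Type*} [MetricSpace X] (A B : ℝ) (c : ℝ≥0 → X) : Prop :=
  ∀ s t : ℝ≥0, A⁻¹ * |(t : ℝ) - s| - B ≤ dist (c s) (c t) ∧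
    dist (c s) (c t) ≤ A * |(t : ℝ) - s| + B

/-- The geodesic region `A(γ, R)`. -/
def geodesicRegion {X : Type*} [MetricSpace X] (γ : GeodesicRay X) (R : ℝ) : Set X :=
  {x | Metric.infDist x (range γ) < R}

/-- `F` has geodesic limit `ξ` at `η`: `F (x n) → ξ` for every sequence `x` converging to `η`
inside some geodesic region with vertex `η`. -/
def HasGeodesicLimit {X Y : Type*} [MetricSpace X] [TopologicalSpace Y] (F : X → Y)
    (η : GromovBoundary X) (ξ : Y) : Prop :=
  ∀ x : ℕ → X,
    Tendsto (fun n => GromovCompactification.point (x n)) atTop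
      (𝓝 (GromovCompactification.bdry η)) →
    (∃ (γ : GeodesicRay X) (R : ℝ), γ.endpoint = η ∧ 0 < R ∧ ∀ n, x n ∈ geodesicRegion γ R) →
    Tendsto (fun n => F (x n)) atTop (𝓝 ξ)

/-- The dilation `λ_{η,p} ∈ (0, ∞]` of `f` at `η` with respect to `p`, given by
`log λ_{η,p} = liminf_{z → η} (d(z, p) - d(f(z), p))`. -/
noncomputable def dilation {X : Type*} [MetricSpace X] (f : X → X) (η : GromovBoundary X)
    (p : X) : ℝ≥0∞ :=
  EReal.exp (liminf (fun z : X => ((dist z p - dist (f z) p : ℝ) : EReal)) (toBoundary η))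

/-- Boundary regular fixed points: the dilation is finite (for each base point; finiteness does
not depend on it) and `f` has geodesic limit `η` at `η`. -/
def IsBRFP {X : Type*} [MetricSpace X] (f : X → X) (η : GromovBoundary X) : Prop :=
  (∀ p : X, dilation f η p < ⊤) ∧
    HasGeodesicLimit (fun x => GromovCompactification.point (f x)) η
      (GromovCompactification.bdry η)

end GromovHyp

namespace GromovHyp

/-! Everything passes through bounded displacement along a ray `γ` ending at `η`, and hyperbolicity
is used only as the four-point inequality for Gromov products, at a cost `κ` per use
(`exists_four_point`). If `z` is far out towards `η`, then `γ t` almost lies on a geodesic from `γ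
0` to `z`. Since `f` is non-expanding, `f (γ t)` is no farther from `f z` than `γ t` is from `z`. If
`z` moves little, this pins `f (γ t)` near `γ t`, uniformly in `t` (`dist_map_ray_le`), so 4 gives
3. If only the dilation is finite, the same argument puts `f (γ t)` and `f (γ T)` almost on a
geodesic from `γ 0` to `f z`. The geodesic limit makes `f (γ T)` point towards `η`, which forces `f
(γ t)` back to `γ t` (`exists_dist_map_ray_le_of_dilation`), so 1 gives 3. The remaining
implications 3 → 4, 3 → 2 and 2 → 1 are evaluations along the ray and the triangle inequality. -/

variable {X : Type*} [MetricSpace X]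

/-! ### Geodesic segments, Gromov products and the four-point inequality -/

theorem IsGeodesicSegment.left_mem {S : Set X} {x y : X} (h : IsGeodesicSegment S x y) :
    x ∈ S := by
  obtain ⟨c, h0, -, -, rfl⟩ := h
  exact ⟨0, ⟨le_rfl, dist_nonneg⟩, h0⟩

theorem IsGeodesicSegment.right_mem {S : Set X} {x y : X} (h : IsGeodesicSegment S x y) :
    y ∈ S := by
  obtain ⟨c, -, h1, -, rfl⟩ := h
  exact ⟨dist x y, ⟨dist_nonneg, le_rfl⟩, h1⟩

theorem IsGeodesicSegment.dist_add_dist {S : Set X} {x y w : X} (h : IsGeodesicSegment S x y)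
    (hw : w ∈ S) : dist x w + dist w y = dist x y := by
  obtain ⟨c, h0, h1, hc, rfl⟩ := h
  obtain ⟨t, ht, rfl⟩ := hw
  have ha := hc 0 ⟨le_rfl, dist_nonneg⟩ t ht
  have hb := hc t ht (dist x y) ⟨dist_nonneg, le_rfl⟩
  rw [h0, zero_sub, abs_neg, abs_of_nonneg ht.1] at ha
  rw [h1, abs_sub_comm, abs_of_nonneg (sub_nonneg.2 ht.2)] at hb
  linarith

theorem IsGeodesicSegment.isPreconnected {S : Set X} {x y : X} (h : IsGeodesicSegment S x y) :
    IsPreconnected S := by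
  obtain ⟨c, -, -, hc, rfl⟩ := h
  refine isPreconnected_Icc.image c (LipschitzOnWith.continuousOn (K := 1) ?_)
  refine LipschitzOnWith.of_dist_le_mul fun s hs t ht => ?_
  rw [hc s hs t ht, NNReal.coe_one, one_mul, Real.dist_eq]

theorem gromovProduct_comm (p x y : X) : gromovProduct p x y = gromovProduct p y x := by
  simp only [gromovProduct, dist_comm x y, add_comm]

theorem gromovProduct_le_dist_of_mem {S : Set X} {x y w : X} (h : IsGeodesicSegment S x y)
    (hw : w ∈ S) (p : X) : gromovProduct p x y ≤ dist w p := by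
  have h1 := h.dist_add_dist hw
  have h2 := dist_triangle x w p
  have h3 := dist_triangle_left y p w
  unfold gromovProduct
  linarith

/-- In a hyperbolic space some point of a geodesic is about as close to `p` as the Gromov
product of its ends. -/
theorem exists_mem_dist_le_gromovProduct (hgeo : IsGeodesicSpace X) {δ : ℝ} (hδ : 0 < δ)
    (hX : IsDeltaHyperbolic X δ) {S : Set X} {x y : X} (h : IsGeodesicSegment S x y) (p : X) :
    ∃ w ∈ S, dist w p ≤ gromovProduct p x y + 2 * δ := by
  obtain ⟨S₂, h₂⟩ := hgeo y p
  obtain ⟨S₃, h₃⟩ := hgeo p x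
  have hsub := hX x y p S S₂ S₃ h h₂ h₃
  -- A connected side covered by the open neighbourhoods of the two other sides, and meeting both,
  -- has a point `w` in their intersection.
  rw [Metric.thickening_union] at hsub
  obtain ⟨w, hwS, hw2, hw3⟩ := h.isPreconnected _ _ Metric.isOpen_thickening
    Metric.isOpen_thickening hsub
    ⟨y, h.right_mem, Metric.self_subset_thickening hδ _ h₂.left_mem⟩
    ⟨x, h.left_mem, Metric.self_subset_thickening hδ _ h₃.right_mem⟩
  obtain ⟨u, hu, hwu⟩ := Metric.mem_thickening_iff.1 hw2
  obtain ⟨v, hv, hwv⟩ := Metric.mem_thickening_iff.1 hw3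
  refine ⟨w, hwS, ?_⟩
  have e1 := h.dist_add_dist hwS
  have e2 := h₂.dist_add_dist hu
  have e3 := h₃.dist_add_dist hv
  have t1 := dist_triangle w u p
  have t2 := dist_triangle w v p
  have t3 := dist_triangle_right y w u
  have t4 := dist_triangle x v w
  simp only [dist_comm y w, dist_comm p v, dist_comm p x, dist_comm v x, dist_comm v w]
    at e1 e2 e3 t1 t2 t3 t4
  unfold gromovProduct
  linarith

/-- Thin triangles imply the four-point inequality for Gromov products. -/
theorem min_gromovProduct_sub_le (hgeo : IsGeodesicSpace X) {δ : ℝ} (hδ : 0 < δ)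
    (hX : IsDeltaHyperbolic X δ) (p x y z : X) :
    min (gromovProduct p x y) (gromovProduct p y z) - 3 * δ ≤ gromovProduct p x z := by
  obtain ⟨S₁, h₁⟩ := hgeo x z
  obtain ⟨S₂, h₂⟩ := hgeo z y
  obtain ⟨S₃, h₃⟩ := hgeo y x
  -- The constant `3 * δ` is `2 * δ` from this choice of `w` plus `δ` from thinness below.
  obtain ⟨w, hw, hwp⟩ := exists_mem_dist_le_gromovProduct hgeo hδ hX h₁ p
  obtain ⟨v, hv, hwv⟩ := Metric.mem_thickening_iff.1 (hX x z y S₁ S₂ S₃ h₁ h₂ h₃ hw)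
  have ht := dist_triangle_left v p w
  rcases hv with hv | hv
  · have h := gromovProduct_le_dist_of_mem h₂ hv p
    rw [gromovProduct_comm] at h
    linarith [min_le_right (gromovProduct p x y) (gromovProduct p y z)]
  · have h := gromovProduct_le_dist_of_mem h₃ hv p
    rw [gromovProduct_comm] at h
    linarith [min_le_left (gromovProduct p x y) (gromovProduct p y z)]

theorem exists_four_point (hgeo : IsGeodesicSpace X) (hhyp : IsGromovHyperbolic X) :
    ∃ κ : ℝ, 0 ≤ κ ∧ ∀ p x y z : X,
      min (gromovProduct p x y) (gromovProduct p y z) - κ ≤ gromovProduct p x z := by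
  obtain ⟨δ, hδ, hX⟩ := hhyp
  exact ⟨3 * δ, by positivity, min_gromovProduct_sub_le hgeo hδ hX⟩

theorem gromovProduct_le_add_dist_base (p q x y : X) :
    gromovProduct p x y ≤ gromovProduct q x y + dist p q := by
  have h1 := dist_triangle_right x p q
  have h2 := dist_triangle_right y p q
  unfold gromovProduct
  linarith

theorem gromovProduct_le_add_dist (p x x' y : X) :
    gromovProduct p x y ≤ gromovProduct p x' y + dist x x' := by
  have h1 := dist_triangle x x' p
  have h2 := dist_triangle_left x' y x
  unfold gromovProduct
  linarith

theorem gromovProduct_le_dist (p x y : X) : gromovProduct p x y ≤ dist x p := by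
  have h := dist_triangle_left y p x
  unfold gromovProduct
  linarith

/-! ### Gromov products along rays -/

theorem GeodesicRay.dist_eq (γ : GeodesicRay X) (s t : ℝ≥0) :
    dist (γ s) (γ t) = |(s : ℝ) - t| := γ.2.dist_eq s t

theorem GeodesicRay.dist_zero (γ : GeodesicRay X) (t : ℝ≥0) : dist (γ t) (γ 0) = t := by
  rw [γ.dist_eq, NNReal.coe_zero, sub_zero, NNReal.abs_eq]

theorem GeodesicRay.gromovProduct_zero (γ : GeodesicRay X) {s t : ℝ≥0} (h : t ≤ s) :
    gromovProduct (γ 0) (γ t) (γ s) = t := by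
  have h' : (t : ℝ) ≤ s := h
  rw [gromovProduct, γ.dist_zero, γ.dist_zero, γ.dist_eq, abs_sub_comm,
    abs_of_nonneg (sub_nonneg.2 h')]
  ring

theorem asymptotic_of_endpoint_eq {γ σ : GeodesicRay X} (h : γ.endpoint = σ.endpoint) :
    Asymptotic γ σ := Quotient.exact h

theorem tendsto_gromovProduct_of_asymptotic {γ σ : GeodesicRay X} (h : Asymptotic γ σ) (p : X) :
    Tendsto (fun st : ℝ≥0 × ℝ≥0 => gromovProduct p (γ st.1) (σ st.2)) (atTop ×ˢ atTop) atTop := by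
  obtain ⟨K, hK⟩ := h
  refine tendsto_atTop.2 fun R => ?_
  obtain ⟨N, hN⟩ := exists_nat_ge (R + K + dist (γ 0) p)
  have e := eventually_ge_atTop (N : ℝ≥0)
  filter_upwards [e.prod_mk e] with ⟨s, t⟩ ⟨hs, ht⟩
  have hs' : (N : ℝ) ≤ s := by exact_mod_cast hs
  have ht' : (N : ℝ) ≤ t := by exact_mod_cast ht
  have hst : (N : ℝ) ≤ gromovProduct (γ 0) (γ s) (γ t) := by
    rcases le_total s t with h | h
    · rwa [γ.gromovProduct_zero h]
    · rwa [gromovProduct_comm, γ.gromovProduct_zero h]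
  have h1 := gromovProduct_le_add_dist_base (γ 0) p (γ s) (γ t)
  have h2 := gromovProduct_le_add_dist p (γ t) (σ t) (γ s)
  rw [gromovProduct_comm p (γ t), gromovProduct_comm p (σ t)] at h2
  linarith [hK t]

/-! ### Convergence to a boundary point -/

theorem basicNhd_anti (η : GromovBoundary X) (p : X) : Antitone (basicNhd η p) :=
  fun _ _ h _ hz σ hσ γ hγ => (hz σ hσ γ hγ).mono fun _ ht => h.trans ht

theorem basicNhd_add_dist_subset (η : GromovBoundary X) (p q : X) (R : ℝ) :
    basicNhd η p (R + dist p q) ⊆ basicNhd η q R := fun _ hz σ hσ γ hγ =>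
  (hz σ hσ γ hγ).mono fun st ht => by
    linarith [gromovProduct_le_add_dist_base p q (σ st.1) (γ st.2)]

theorem hasBasis_gromovNhds_bdry (η : GromovBoundary X) (p : X) :
    (gromovNhds (.bdry η)).HasBasis (fun _ : ℝ => True) (basicNhd η p) := by
  have h : gromovNhds (.bdry η) = ⨅ R : ℝ, 𝓟 (basicNhd η p R) := by
    refine le_antisymm (iInf_le _ p) (le_iInf fun q => le_iInf fun R => ?_)
    exact (iInf_le _ (R + dist p q)).trans
      (principal_mono.2 (basicNhd_add_dist_subset η p q R))
  rw [h]
  exact hasBasis_iInf_principal (basicNhd_anti η p).directed_ge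

theorem bdry_mem_basicNhd (η : GromovBoundary X) (p : X) (R : ℝ) :
    .bdry η ∈ basicNhd η p R := by
  rintro _ ⟨σ, hσ, rfl⟩ _ ⟨γ, hγ, rfl⟩
  exact (tendsto_gromovProduct_of_asymptotic
    (asymptotic_of_endpoint_eq (hσ.trans hγ.symm)) p).eventually_ge_atTop R

theorem point_mem_basicNhd_iff {η : GromovBoundary X} {p : X} {R : ℝ} {x : X} :
    .point x ∈ basicNhd η p R ↔
      ∀ γ : GeodesicRay X, γ.endpoint = η → ∀ᶠ t in atTop, R ≤ gromovProduct p x (γ t) := by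
  constructor
  · intro h γ hγ
    obtain ⟨_, hs⟩ := (h (fun _ => x) rfl γ ⟨γ, hγ, rfl⟩).curry.exists
    exact hs
  · rintro h _ rfl _ ⟨γ, hγ, rfl⟩
    exact tendsto_snd.eventually (h γ hγ)

/-- Change of representative ray: in a hyperbolic space this costs at most `κ`. -/
theorem eventually_gromovProduct_of_endpoint_eq {κ : ℝ}
    (hκ : ∀ p x y z : X,
      min (gromovProduct p x y) (gromovProduct p y z) - κ ≤ gromovProduct p x z)
    {γ σ : GeodesicRay X} (hγσ : γ.endpoint = σ.endpoint) {p x : X} {R : ℝ}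
    (h : ∀ᶠ t in atTop, R + κ ≤ gromovProduct p x (γ t)) :
    ∀ᶠ t in atTop, R ≤ gromovProduct p x (σ t) := by
  -- Currying yields one time `s` good for both estimates; the four-point inequality then passes
  -- through `γ s`.
  have h2 := ((tendsto_gromovProduct_of_asymptotic
    (asymptotic_of_endpoint_eq hγσ) p).eventually_ge_atTop (R + κ)).curry
  obtain ⟨s, hs, hs'⟩ := (h.and h2).exists
  filter_upwards [hs'] with t ht
  linarith [hκ p x (γ s) (σ t), le_min hs ht]

/-- The four-point inequality supplies the openness axiom: a basic neighbourhood with a larger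
parameter consists of points having the smaller one as a neighbourhood. -/
theorem nhds_bdry (hgeo : IsGeodesicSpace X) (hhyp : IsGromovHyperbolic X)
    (η : GromovBoundary X) :
    𝓝 (GromovCompactification.bdry η) = gromovNhds (.bdry η) := by
  obtain ⟨κ, hκ0, hκ⟩ := exists_four_point hgeo hhyp
  refine TopologicalSpace.nhds_mkOfNhds _ _ ?_ ?_
  · rintro (x | ξ)
    · rw [gromovNhds, ← Filter.map_pure]
      exact map_mono (pure_le_nhds x)
    · obtain ⟨γ, -⟩ := Quotient.exists_rep ξ
      intro s hs
      obtain ⟨R, -, hR⟩ := (hasBasis_gromovNhds_bdry ξ (γ 0)).mem_iff.1 hs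
      exact hR (bdry_mem_basicNhd ξ _ R)
  · rintro (x | ξ) s hs
    · have hs' : ∀ᶠ y in 𝓝 x, GromovCompactification.point y ∈ s := hs
      exact eventually_eventually_nhds.2 hs'
    · obtain ⟨γ, -⟩ := Quotient.exists_rep ξ
      obtain ⟨R, -, hR⟩ := (hasBasis_gromovNhds_bdry ξ (γ 0)).mem_iff.1 hs
      -- The `1` pays for a unit ball around a point of `X`, the `κ` for passing through a ray `τ`
      -- that represents a nearby boundary point.
      refine ((hasBasis_gromovNhds_bdry ξ (γ 0)).mem_of_mem (i := R + κ + 1) trivial) |>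
        mem_of_superset <| ?_
      rintro (x | ζ) hz
      · refine mem_of_superset (Metric.ball_mem_nhds x one_pos) fun y hy => hR ?_
        rw [point_mem_basicNhd_iff] at hz ⊢
        refine fun σ hσ => (hz σ hσ).mono fun t ht => ?_
        linarith [gromovProduct_le_add_dist (γ 0) x y (σ t), Metric.mem_ball'.1 hy]
      · obtain ⟨τ, hτ⟩ := Quotient.exists_rep ζ
        refine ((hasBasis_gromovNhds_bdry ζ (γ 0)).mem_of_mem (i := R + κ + 1) trivial) |>
          mem_of_superset <| fun z hzζ => hR ?_
        intro σ hσ ρ hρ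
        have h1 := hzζ σ hσ τ ⟨τ, hτ, rfl⟩
        have h2 := hz τ ⟨τ, hτ, rfl⟩ ρ hρ
        obtain ⟨a, ha, b, hb, h1⟩ := eventually_prod_iff.1 h1
        obtain ⟨c, hc, d, hd, h2⟩ := eventually_prod_iff.1 h2
        obtain ⟨u, hub, huc⟩ := (hb.and hc).exists
        filter_upwards [ha.prod_mk hd] with st hst
        linarith [hκ (γ 0) (σ st.1) (τ u) (ρ st.2), le_min (h1 hst.1 hub) (h2 huc hst.2)]

/-- A single ray is enough to describe convergence to a boundary point. -/
theorem hasBasis_toBoundary (hgeo : IsGeodesicSpace X) (hhyp : IsGromovHyperbolic X)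
    (γ : GeodesicRay X) (p : X) :
    (toBoundary γ.endpoint).HasBasis (fun _ : ℝ => True)
      fun R => {x | ∀ᶠ t in atTop, R ≤ gromovProduct p x (γ t)} := by
  obtain ⟨κ, -, hκ⟩ := exists_four_point hgeo hhyp
  rw [toBoundary, nhds_bdry hgeo hhyp]
  refine ((hasBasis_gromovNhds_bdry γ.endpoint p).comap _).to_hasBasis ?_ ?_
  · refine fun R _ => ⟨R + κ, trivial, fun x hx => point_mem_basicNhd_iff.2 fun σ hσ => ?_⟩
    exact eventually_gromovProduct_of_endpoint_eq hκ hσ.symm hx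
  · exact fun R _ => ⟨R, trivial, fun x hx => point_mem_basicNhd_iff.1 hx γ rfl⟩

theorem tendsto_point_bdry_iff (hgeo : IsGeodesicSpace X) (hhyp : IsGromovHyperbolic X)
    {ι : Type*} {l : Filter ι} {u : ι → X} (γ : GeodesicRay X) (p : X) :
    Tendsto (fun i => GromovCompactification.point (u i)) l (𝓝 (.bdry γ.endpoint)) ↔
      ∀ R : ℝ, ∀ᶠ i in l, ∀ᶠ t in atTop, R ≤ gromovProduct p (u i) (γ t) := by
  have h : Tendsto (fun i => GromovCompactification.point (u i)) l (𝓝 (.bdry γ.endpoint)) ↔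
    Tendsto u l (toBoundary γ.endpoint) := tendsto_comap_iff.symm
  rw [h, (hasBasis_toBoundary hgeo hhyp γ p).tendsto_right_iff]
  simp

theorem tendsto_ray (hgeo : IsGeodesicSpace X) (hhyp : IsGromovHyperbolic X)
    (γ : GeodesicRay X) :
    Tendsto (fun t => GromovCompactification.point (γ t)) atTop (𝓝 (.bdry γ.endpoint)) := by
  refine (tendsto_point_bdry_iff hgeo hhyp γ (γ 0)).2 fun R => ?_
  filter_upwards [NNReal.tendsto_coe_atTop.2 tendsto_id |>.eventually_ge_atTop R] with s hs
  filter_upwards [eventually_ge_atTop s] with t ht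
  rwa [γ.gromovProduct_zero ht]

theorem tendsto_of_dist_le (hgeo : IsGeodesicSpace X) (hhyp : IsGromovHyperbolic X)
    {ι : Type*} {l : Filter ι} {u v : ι → X} {η : GromovBoundary X} {C : ℝ}
    (hu : Tendsto (fun i => GromovCompactification.point (u i)) l (𝓝 (.bdry η)))
    (huv : ∀ i, dist (u i) (v i) ≤ C) :
    Tendsto (fun i => GromovCompactification.point (v i)) l (𝓝 (.bdry η)) := by
  obtain ⟨γ, rfl⟩ := Quotient.exists_rep η
  refine (tendsto_point_bdry_iff hgeo hhyp γ (γ 0)).2 fun R => ?_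
  filter_upwards [(tendsto_point_bdry_iff hgeo hhyp γ (γ 0)).1 hu (R + C)] with i hi
  filter_upwards [hi] with t ht
  linarith [huv i, gromovProduct_le_add_dist (γ 0) (u i) (v i) (γ t)]

theorem tendsto_dist_of_tendsto_bdry (hgeo : IsGeodesicSpace X) (hhyp : IsGromovHyperbolic X)
    {ι : Type*} {l : Filter ι} {u : ι → X} {η : GromovBoundary X} (p : X)
    (hu : Tendsto (fun i => GromovCompactification.point (u i)) l (𝓝 (.bdry η))) :
    Tendsto (fun i => dist (u i) p) l atTop := by
  obtain ⟨γ, rfl⟩ := Quotient.exists_rep η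
  refine tendsto_atTop.2 fun R => ?_
  filter_upwards [(tendsto_point_bdry_iff hgeo hhyp γ p).1 hu R] with i hi
  obtain ⟨t, ht⟩ := hi.exists
  exact ht.trans (gromovProduct_le_dist p _ _)

/-! ### Finite liminf and limsup as real bounds -/

theorem liminf_coe_lt_top_iff {α : Type*} {l : Filter α} {u : α → ℝ} :
    liminf (fun a => (u a : EReal)) l < ⊤ ↔ ∃ C : ℝ, ∃ᶠ a in l, u a ≤ C := by
  constructor
  · intro h
    obtain ⟨C, hC, -⟩ := EReal.lt_iff_exists_real_btwn.1 h
    exact ⟨C, (frequently_lt_of_liminf_lt (by isBoundedDefault) hC).mono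
      fun a ha => (EReal.coe_lt_coe_iff.1 ha).le⟩
  · rintro ⟨C, hC⟩
    exact (liminf_le_of_frequently_le' (hC.mono fun a ha => EReal.coe_le_coe_iff.2 ha)).trans_lt
      (EReal.coe_lt_top C)

theorem limsup_coe_lt_top_iff {α : Type*} {l : Filter α} {u : α → ℝ} :
    limsup (fun a => (u a : EReal)) l < ⊤ ↔ ∃ C : ℝ, ∀ᶠ a in l, u a ≤ C := by
  constructor
  · intro h
    obtain ⟨C, hC, -⟩ := EReal.lt_iff_exists_real_btwn.1 h
    exact ⟨C, (eventually_lt_of_limsup_lt hC).mono fun a ha => (EReal.coe_lt_coe_iff.1 ha).le⟩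
  · rintro ⟨C, hC⟩
    exact (limsup_le_of_le (by isBoundedDefault)
      (hC.mono fun a ha => EReal.coe_le_coe_iff.2 ha)).trans_lt (EReal.coe_lt_top C)

/-! ### Bounding the displacement along a ray -/

/-- A point whose Gromov product with the endpoint of a ray is at least `t` is joined to the
origin of the ray by geodesics that fellow travel the ray up to time `t`. -/
theorem sub_le_gromovProduct_ray {κ : ℝ}
    (hκ : ∀ p x y z : X,
      min (gromovProduct p x y) (gromovProduct p y z) - κ ≤ gromovProduct p x z)
    (γ : GeodesicRay X) {z : X} {t : ℝ≥0} {R : ℝ} (hR : R ≤ t)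
    (h : ∀ᶠ s in atTop, R ≤ gromovProduct (γ 0) z (γ s)) :
    R - κ ≤ gromovProduct (γ 0) z (γ t) := by
  obtain ⟨s, hs, hts⟩ := (h.and (eventually_ge_atTop t)).exists
  have h1 := γ.gromovProduct_zero hts
  rw [gromovProduct_comm] at h1
  linarith [hκ (γ 0) z (γ s) (γ t), le_min hs (hR.trans h1.ge)]

/-- Apply the four-point inequality to `γ t`, `z`, `f (γ t)`. If the first product is the minimum,
the displacement of `γ 0` controls the bound; otherwise that of `z` does. Neither bound involves
`t`, so `z` may depend on `t`. -/
theorem dist_map_ray_le {κ C : ℝ}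
    (hκ : ∀ p x y z : X,
      min (gromovProduct p x y) (gromovProduct p y z) - κ ≤ gromovProduct p x z)
    {f : X → X} (hf : ∀ x y : X, dist (f x) (f y) ≤ dist x y) (γ : GeodesicRay X) {z : X}
    {t : ℝ≥0} (hz : ∀ᶠ s in atTop, (t : ℝ) ≤ gromovProduct (γ 0) z (γ s))
    (hC : dist z (f z) ≤ C) :
    dist (γ t) (f (γ t)) ≤ max C (dist (f (γ 0)) (γ 0)) + 4 * κ := by
  have h1 := sub_le_gromovProduct_ray hκ γ le_rfl hz
  have h2 := hκ (γ 0) (γ t) z (f (γ t))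
  have h3 := dist_triangle z (f z) (f (γ t))
  have h4 := hf z (γ t)
  have h5 := dist_triangle (f (γ t)) (f (γ 0)) (γ 0)
  have h6 := hf (γ t) (γ 0)
  have h7 := γ.dist_zero t
  have hm1 := le_max_left C (dist (f (γ 0)) (γ 0))
  have hm2 := le_max_right C (dist (f (γ 0)) (γ 0))
  rw [gromovProduct_comm (γ 0) (γ t) z] at h2
  rcases min_choice (gromovProduct (γ 0) z (γ t)) (gromovProduct (γ 0) z (f (γ t))) with h | h <;>
  · rw [h] at h2
    unfold gromovProduct at h1 h2
    linarith

/-- If `f` is non-expanding and moves points arbitrarily close to the endpoint of `γ` by a bounded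
amount, then it moves all the points of `γ` by a bounded amount. -/
theorem exists_dist_map_ray_le_of_frequently (hgeo : IsGeodesicSpace X)
    (hhyp : IsGromovHyperbolic X) {f : X → X} (hf : ∀ x y : X, dist (f x) (f y) ≤ dist x y)
    (γ : GeodesicRay X) {C : ℝ} (h : ∃ᶠ z in toBoundary γ.endpoint, dist z (f z) ≤ C) :
    ∃ C' : ℝ, ∀ t, dist (γ t) (f (γ t)) ≤ C' := by
  obtain ⟨κ, -, hκ⟩ := exists_four_point hgeo hhyp
  refine ⟨max C (dist (f (γ 0)) (γ 0)) + 4 * κ, fun t => ?_⟩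
  obtain ⟨z, hz, hzt⟩ := (hasBasis_toBoundary hgeo hhyp γ (γ 0)).frequently_iff.1 h (i := t) trivial
  exact dist_map_ray_le hκ hf γ hz hzt

/-- Finite dilation and convergence of `f ∘ γ` to the endpoint of `γ` imply that `f` moves the
points of `γ` by a bounded amount. -/
theorem exists_dist_map_ray_le_of_dilation (hgeo : IsGeodesicSpace X)
    (hhyp : IsGromovHyperbolic X) {f : X → X} (hf : ∀ x y : X, dist (f x) (f y) ≤ dist x y)
    (γ : GeodesicRay X) {C : ℝ}
    (h : ∃ᶠ z in toBoundary γ.endpoint, dist z (γ 0) - dist (f z) (γ 0) ≤ C)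
    (hlim : ∀ R : ℝ, ∃ T : ℝ≥0, R ≤ T ∧
      ∀ᶠ s in atTop, R ≤ gromovProduct (γ 0) (f (γ T)) (γ s)) :
    ∃ C' : ℝ, ∀ t, dist (γ t) (f (γ t)) ≤ C' := by
  obtain ⟨κ, hκ0, hκ⟩ := exists_four_point hgeo hhyp
  have hC0 : 0 ≤ max C 0 := le_max_right _ _
  have hC1 : C ≤ max C 0 := le_max_left _ _
  generalize max C 0 = C₁ at hC0 hC1
  set D := dist (f (γ 0)) (γ 0) with hD
  have hD0 : 0 ≤ D := dist_nonneg
  refine ⟨D + 2 * (C₁ + 5 * κ), fun t => ?_⟩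
  -- The threshold absorbs the loss in `key` at `u = T`, leaving a product of at least `t`.
  obtain ⟨T, hT, hTs⟩ := hlim (t + C₁ + 2 * κ)
  obtain ⟨z, hz, hzC⟩ := (hasBasis_toBoundary hgeo hhyp γ (γ 0)).frequently_iff.1 h
    (i := max (T : ℝ) t) trivial
  -- the images of points of the ray are still well aligned with `f z`
  have key : ∀ u : ℝ≥0, (u : ℝ) ≤ max (T : ℝ) t →
      u - C₁ - 2 * κ ≤ gromovProduct (γ 0) (f (γ u)) (f z) := by
    intro u hu
    have h1 := sub_le_gromovProduct_ray hκ γ le_rfl (hz.mono fun s hs => hu.trans hs)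
    have h2 := hf (γ u) z
    have h3 := dist_triangle_left (f z) (γ 0) (f (γ u))
    have h4 := γ.dist_zero u
    unfold gromovProduct at h1 ⊢
    rw [dist_comm (γ u) z] at h2
    linarith
  have k1 := key t (le_max_right _ _)
  have k2 := key T (le_max_left _ _)
  rw [gromovProduct_comm] at k2
  obtain ⟨s, hs, hts⟩ := (hTs.and (eventually_ge_atTop t)).exists
  -- Chain `f (γ t)`, `f z`, `f (γ T)`, `γ s`, `γ t`: three further losses of `κ`.
  have a1 := hκ (γ 0) (f (γ t)) (f z) (f (γ T))
  have b1 : (t : ℝ) - C₁ - 2 * κ ≤ min (gromovProduct (γ 0) (f (γ t)) (f z))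
    (gromovProduct (γ 0) (f z) (f (γ T))) := le_min k1 (by linarith)
  have a2 := hκ (γ 0) (f (γ t)) (f (γ T)) (γ s)
  have b2 : (t : ℝ) - C₁ - 3 * κ ≤ min (gromovProduct (γ 0) (f (γ t)) (f (γ T)))
    (gromovProduct (γ 0) (f (γ T)) (γ s)) := le_min (by linarith) (by linarith)
  have a3 := hκ (γ 0) (f (γ t)) (γ s) (γ t)
  have e := γ.gromovProduct_zero hts
  rw [gromovProduct_comm] at e
  have b3 : (t : ℝ) - C₁ - 4 * κ ≤ min (gromovProduct (γ 0) (f (γ t)) (γ s))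
    (gromovProduct (γ 0) (γ s) (γ t)) := le_min (by linarith) (by linarith)
  have a4 : (t : ℝ) - C₁ - 5 * κ ≤ gromovProduct (γ 0) (f (γ t)) (γ t) := by linarith
  have h5 := dist_triangle (f (γ t)) (f (γ 0)) (γ 0)
  have h6 := hf (γ t) (γ 0)
  have h7 := γ.dist_zero t
  unfold gromovProduct at a4
  rw [dist_comm]
  linarith

/-! ### Quasi-geodesic images and the return to regular fixed points -/

theorem isQuasiGeodesicRay_map {f : X → X} (hf : ∀ x y : X, dist (f x) (f y) ≤ dist x y)
    (γ : GeodesicRay X) {C : ℝ} (hC : ∀ t, dist (γ t) (f (γ t)) ≤ C) :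
    IsQuasiGeodesicRay 1 (2 * C) fun t => f (γ t) := by
  intro s t
  have h0 : 0 ≤ C := dist_nonneg.trans (hC 0)
  have h1 := hf (γ s) (γ t)
  have h2 := dist_triangle4 (γ s) (f (γ s)) (f (γ t)) (γ t)
  have h3 := hC s
  have h4 := hC t
  rw [γ.dist_eq, abs_sub_comm] at h1 h2
  rw [dist_comm (f (γ t))] at h2
  rw [inv_one, one_mul]
  constructor <;> linarith

theorem exists_forall_dist_map_ray_le {f : X → X}
    (hf : ∀ x y : X, dist (f x) (f y) ≤ dist x y) (γ : GeodesicRay X) {C : ℝ}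
    (h : ∀ᶠ t in atTop, dist (γ t) (f (γ t)) ≤ C) :
    ∃ C' : ℝ, ∀ t, dist (γ t) (f (γ t)) ≤ C' := by
  obtain ⟨T, hT⟩ := eventually_atTop.1 h
  -- Before time `T`, the ray and its image each move at most `T` away from their positions at `T`.
  refine ⟨C + 2 * T, fun t => ?_⟩
  rcases le_total T t with ht | ht
  · exact (hT t ht).trans (le_add_of_nonneg_right (by positivity))
  · have ht' : (t : ℝ) ≤ T := ht
    have h1 := dist_triangle4 (γ t) (γ T) (f (γ T)) (f (γ t))
    have h2 := hf (γ T) (γ t)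
    have h3 := γ.dist_eq T t
    rw [abs_of_nonneg (sub_nonneg.2 ht')] at h3
    rw [dist_comm (γ t) (γ T)] at h1
    linarith [hT T le_rfl, t.coe_nonneg]

/-- A liminf is bounded by its values along any one approach. Along `γ`, both `γ t` and `f (γ t)`
recede from `p` at unit speed up to bounded error. -/
theorem dilation_lt_top (hgeo : IsGeodesicSpace X) (hhyp : IsGromovHyperbolic X) {f : X → X}
    (γ : GeodesicRay X) {B : ℝ} (hB : IsQuasiGeodesicRay 1 B fun t => f (γ t)) (p : X) :
    dilation f γ.endpoint p < ⊤ := by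
  refine EReal.exp_lt_top_iff.2 (liminf_coe_lt_top_iff.2
    ⟨dist (γ 0) p + dist (f (γ 0)) p + B, ?_⟩)
  have ht : Tendsto γ atTop (toBoundary γ.endpoint) :=
    tendsto_comap_iff.2 (tendsto_ray hgeo hhyp γ)
  refine ht.frequently (Frequently.of_forall fun t => ?_)
  have h1 := (hB 0 t).1
  rw [inv_one, one_mul, NNReal.coe_zero, sub_zero, NNReal.abs_eq] at h1
  have h2 := dist_triangle_right (f (γ 0)) (f (γ t)) p
  have h3 := dist_triangle (γ t) (γ 0) p
  rw [γ.dist_zero] at h3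
  linarith

/-- Any sequence in a geodesic region is shadowed by points `γ (t n)` with `t n → ∞`, and `f`
preserves the bound on the distance. -/
theorem hasGeodesicLimit_of_tendsto_ray (hgeo : IsGeodesicSpace X) (hhyp : IsGromovHyperbolic X)
    {f : X → X} (hf : ∀ x y : X, dist (f x) (f y) ≤ dist x y) (γ : GeodesicRay X)
    {ξ : GromovBoundary X}
    (h : Tendsto (fun t => GromovCompactification.point (f (γ t))) atTop (𝓝 (.bdry ξ))) :
    HasGeodesicLimit (fun x => GromovCompactification.point (f x)) γ.endpoint (.bdry ξ) := by
  rintro x hx ⟨σ, R, hσ, -, hR⟩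
  obtain ⟨K, hK⟩ := asymptotic_of_endpoint_eq hσ
  have hex : ∀ n, ∃ t : ℝ≥0, dist (x n) (γ t) ≤ R + K := by
    intro n
    obtain ⟨_, ⟨t, rfl⟩, ht⟩ := (Metric.infDist_lt_iff (range_nonempty _)).1 (hR n)
    exact ⟨t, by linarith [dist_triangle (x n) (σ t) (γ t), hK t]⟩
  choose t ht using hex
  have htop : Tendsto t atTop atTop := by
    refine NNReal.tendsto_coe_atTop.1 (tendsto_atTop_mono (fun n => ?_)
      (tendsto_atTop_add_const_right atTop (-(R + K))
        (tendsto_dist_of_tendsto_bdry hgeo hhyp (γ 0) hx)))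
    have h1 := dist_triangle (x n) (γ (t n)) (γ 0)
    rw [γ.dist_zero] at h1
    linarith [ht n]
  refine tendsto_of_dist_le hgeo hhyp (h.comp htop) (C := R + K) fun n => ?_
  rw [dist_comm]
  exact (hf _ _).trans (ht n)

theorem IsBRFP.exists_dist_map_ray_le (hgeo : IsGeodesicSpace X) (hhyp : IsGromovHyperbolic X)
    {f : X → X} (hf : ∀ x y : X, dist (f x) (f y) ≤ dist x y) (γ : GeodesicRay X)
    (h : IsBRFP f γ.endpoint) : ∃ C : ℝ, ∀ t, dist (γ t) (f (γ t)) ≤ C := by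
  obtain ⟨C, hC⟩ := liminf_coe_lt_top_iff.1 (EReal.exp_lt_top_iff.1 (h.1 (γ 0)))
  refine exists_dist_map_ray_le_of_dilation hgeo hhyp hf γ hC fun R => ?_
  have hlim := h.2 (fun n : ℕ => γ n)
    ((tendsto_ray hgeo hhyp γ).comp tendsto_natCast_atTop_atTop)
    ⟨γ, 1, rfl, one_pos, fun n => by
      rw [geodesicRegion, mem_ofPred_eq, Metric.infDist_zero_of_mem (mem_range_self _)]
      exact one_pos⟩
  obtain ⟨n, hn, hRn⟩ := (((tendsto_point_bdry_iff hgeo hhyp γ (γ 0)).1 hlim R).and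
    (tendsto_natCast_atTop_atTop.eventually_ge_atTop R)).exists
  exact ⟨n, by simpa using hRn, hn⟩

end GromovHyp

theorem mainTheorem10 {X : Type*} [MetricSpace X] [ProperSpace X]
    (hgeo : GromovHyp.IsGeodesicSpace X) (hhyp : GromovHyp.IsGromovHyperbolic X)
    (f : X → X) (hf : ∀ x y : X, dist (f x) (f y) ≤ dist x y)
    (η : GromovHyp.GromovBoundary X) :
    List.TFAE [
      GromovHyp.IsBRFP f η,
      ∃ γ : GromovHyp.GeodesicRay X, γ.endpoint = η ∧
        (∃ B : ℝ, 0 ≤ B ∧ GromovHyp.IsQuasiGeodesicRay 1 B (fun t => f (γ t))) ∧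
        Tendsto (fun t => GromovHyp.GromovCompactification.point (f (γ t))) atTop
          (𝓝 (GromovHyp.GromovCompactification.bdry η)),
      ∃ γ : GromovHyp.GeodesicRay X, γ.endpoint = η ∧
        limsup (fun t : ℝ≥0 => ((dist (γ t) (f (γ t)) : ℝ) : EReal)) atTop < ⊤,
      liminf (fun z : X => ((dist z (f z) : ℝ) : EReal)) (GromovHyp.toBoundary η) < ⊤] := by
  obtain ⟨γ, rfl⟩ : ∃ γ : GromovHyp.GeodesicRay X, γ.endpoint = η := Quotient.exists_rep η
  tfae_have 1 → 3 := by
    intro h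
    obtain ⟨C, hC⟩ := h.exists_dist_map_ray_le hgeo hhyp hf γ
    exact ⟨γ, rfl, GromovHyp.limsup_coe_lt_top_iff.2 ⟨C, .of_forall hC⟩⟩
  tfae_have 3 → 4 := by
    rintro ⟨σ, hσ, h⟩
    obtain ⟨C, hC⟩ := GromovHyp.limsup_coe_lt_top_iff.1 h
    have ht : Tendsto σ atTop (GromovHyp.toBoundary σ.endpoint) :=
      tendsto_comap_iff.2 (GromovHyp.tendsto_ray hgeo hhyp σ)
    rw [← hσ]
    exact GromovHyp.liminf_coe_lt_top_iff.2 ⟨C, ht.frequently hC.frequently⟩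
  tfae_have 4 → 3 := by
    intro h
    obtain ⟨C, hC⟩ := GromovHyp.liminf_coe_lt_top_iff.1 h
    obtain ⟨C', hC'⟩ := GromovHyp.exists_dist_map_ray_le_of_frequently hgeo hhyp hf γ hC
    exact ⟨γ, rfl, GromovHyp.limsup_coe_lt_top_iff.2 ⟨C', .of_forall hC'⟩⟩
  tfae_have 3 → 2 := by
    rintro ⟨σ, hσ, h⟩
    obtain ⟨C, hC⟩ := GromovHyp.limsup_coe_lt_top_iff.1 h
    obtain ⟨C', hC'⟩ := GromovHyp.exists_forall_dist_map_ray_le hf σ hC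
    have h0 : 0 ≤ C' := dist_nonneg.trans (hC' 0)
    refine ⟨σ, hσ, ⟨2 * C', by positivity, GromovHyp.isQuasiGeodesicRay_map hf σ hC'⟩, ?_⟩
    rw [← hσ]
    exact GromovHyp.tendsto_of_dist_le hgeo hhyp (GromovHyp.tendsto_ray hgeo hhyp σ) hC'
  tfae_have 2 → 1 := by
    rintro ⟨σ, hσ, ⟨B, -, hB⟩, h⟩
    rw [← hσ] at h ⊢
    exact ⟨GromovHyp.dilation_lt_top hgeo hhyp σ hB,
      GromovHyp.hasGeodesicLimit_of_tendsto_ray hgeo hhyp hf σ h⟩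
  tfae_finish
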